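/- **Theorem 3.3 (classical Nash equilibrium theorem).** Let $\Omega_1 \subset \mathbb{R}^m$ and $\Omega_2 \subset \mathbb{R}^n$ be nonempty compact convex sets, let $A$ be a real $m \times n$ matrix and $B$ a real $n \times m$ matrix, and consider the two-person game with strategy sets $\Omega_1, \Omega_2$ and payoff functions $u_1, u_2 \colon \Omega_1 \times \Omega_2 \to \mathbb{R}$ given by $$u_1(p,q) := p^T A q \quad\text{and}\quad u_2(p,q) := q^T B p.$$ Then this game admits a Nash equilibrium, that is, there is a pair $(\bar p, \bar q) \in \Omega_1 \times \Omega_2$ such that $$u_1(p, \bar q) \le u_1(\bar p, \bar q) \ \text{ for all } p \in \Omega_1 \qquad\text{and}\qquad u_2(\bar p, q) \le u_2(\bar p, \bar q) \ \text{ for all } q \in \Omega_2.$$ -/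

import Mathlib

/-- `z = (x̄, ȳ)` is a Nash equilibrium of the two-person game with strategy sets `Ω₁`, `Ω₂` and
payoff functions `u₁`, `u₂` (each player maximizes the own payoff): `z ∈ Ω₁ × Ω₂`, and no player
can increase the own payoff by a unilateral change of strategy. Only the values of the payoffs
on `Ω₁ × Ω₂` matter. -/
def IsNashEquilibrium {X Y : Type*} (Ω₁ : Set X) (Ω₂ : Set Y) (u₁ u₂ : X → Y → ℝ)
    (z : X × Y) : Prop :=
  z ∈ Ω₁ ×ˢ Ω₂ ∧
    (∀ x ∈ Ω₁, u₁ x z.2 ≤ u₁ z.1 z.2) ∧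
    (∀ y ∈ Ω₂, u₂ z.1 y ≤ u₂ z.1 z.2)

/-- The bilinear form `xᵀ M y` of a real matrix `M`. -/
def bilinearPayoff {k l : ℕ} (M : Matrix (Fin k) (Fin l) ℝ)
    (x : EuclideanSpace ℝ (Fin k)) (y : EuclideanSpace ℝ (Fin l)) : ℝ :=
  x.ofLp ⬝ᵥ M.mulVec y.ofLp

/-! Let f(x, y) be the sum of the gains the players obtain by deviating from x, each alone, to their
components of y. It vanishes for y = x and is affine in y. A point x with f(x, y) ≤ 0 for all y is
an equilibrium, and Ky Fan's inequality (`exists_mem_forall_le_zero_of_concaveOn`) supplies one.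
Compactness reduces that inequality to finitely many y, where it follows from Brouwer's theorem on a
simplex (`exists_fixedPoint_stdSimplex`).

Brouwer's theorem comes from Scarf's lemma (`exists_isDominating_image_eq_univ`), a parity argument.
A room is a dominating set with as many vertices as there are orders; a door is a dominating set
with one vertex fewer that carries every colour but i₀. A room lacking a colour contains an even
number of doors. Each door lies in two rooms, except one boundary door, which lies in one. Counting
incidences forces a room with all colours. On a fine grid of the simplex, ordered by coordinates and
coloured by a coordinate that the map does not decrease, such a room yields an almost fixed point.
-/

/-! ### Dominating sets -/

/-- A finite set `D` is dominating for a family of orders, given by rank functions `r i`, if no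
vertex lies strictly above the minimum of `D` in all of the orders at once. -/
def IsDominating {I V : Type*} (r : I → V → ℕ) (D : Finset V) : Prop :=
  ∀ z, ∃ i, ∀ x ∈ D, r i z ≤ r i x

theorem IsDominating.mono {I V : Type*} {r : I → V → ℕ} {D E : Finset V}
    (h : IsDominating r E) (hDE : D ⊆ E) : IsDominating r D := fun z =>
  (h z).imp fun _ hi x hx => hi x (hDE hx)

section Scarf

variable {I V : Type*} {r : I → V → ℕ} {D : Finset V} {mn : I → V}

theorem exists_argmin (hne : D.Nonempty) (r : I → V → ℕ) :
    ∃ mn : I → V, (∀ k, mn k ∈ D) ∧ ∀ k, ∀ x ∈ D, r k (mn k) ≤ r k x := by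
  choose mn h1 h2 using fun k => Finset.exists_min_image D (r k) hne
  exact ⟨mn, h1, h2⟩

theorem exists_argmax_above [Fintype V] (mn : I → V) (l : I) (v : V)
    (hv : ∀ k, k ≠ l → r k (mn k) < r k v) :
    ∃ y, (∀ k, k ≠ l → r k (mn k) < r k y) ∧
      ∀ z, (∀ k, k ≠ l → r k (mn k) < r k z) → r l z ≤ r l y := by
  classical
  obtain ⟨y, hy, hmax⟩ := Finset.exists_max_image
    (Finset.univ.filter fun z => ∀ k, k ≠ l → r k (mn k) < r k z) (r l) ⟨v, by simpa using hv⟩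
  exact ⟨y, by simpa using hy, fun z hz => hmax z (by simpa using hz)⟩

theorem IsDominating.exists_argmin_eq (hr : ∀ i, Function.Injective (r i))
    (hmem : ∀ k, mn k ∈ D) (hmin : ∀ k, ∀ x ∈ D, r k (mn k) ≤ r k x)
    (hD : IsDominating r D) {x : V} (hx : x ∈ D) : ∃ k, mn k = x := by
  obtain ⟨k, hk⟩ := hD x
  exact ⟨k, hr k (le_antisymm (hmin k x hx) (hk _ (hmem k)))⟩

variable [Fintype I]

theorem IsDominating.exists_argmin_collision (hcard : D.card + 1 = Fintype.card I)
    (hmem : ∀ k, mn k ∈ D) : ∃ i j, i ≠ j ∧ mn i = mn j := by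
  obtain ⟨i, -, j, -, hij, h⟩ := Finset.exists_ne_map_eq_of_card_lt_of_maps_to
    (s := Finset.univ) (t := D) (f := mn) (by rw [Finset.card_univ]; omega)
    (fun k _ => hmem k)
  exact ⟨i, j, hij, h⟩

/-! ### Rooms, doors and Scarf's parity argument -/

variable {s : I → V} {c : V → I}

/-- The rooms containing `D`. -/
noncomputable def roomsAbove [Fintype V] (r : I → V → ℕ) (D : Finset V) : Finset (Finset V) := by
  classical exact Finset.univ.filter fun R =>
    (R.card = Fintype.card I ∧ IsDominating r R) ∧ D ⊆ R

theorem mem_roomsAbove [Fintype V] {R : Finset V} : R ∈ roomsAbove r D ↔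
    (R.card = Fintype.card I ∧ IsDominating r R) ∧ D ⊆ R := by
  simp [roomsAbove]

variable [DecidableEq V]

theorem mem_roomsAbove_iff_exists [Fintype V] (hcard : D.card + 1 = Fintype.card I) {R : Finset V} :
    R ∈ roomsAbove r D ↔ ∃ y, (y ∉ D ∧ IsDominating r (insert y D)) ∧ insert y D = R := by
  rw [mem_roomsAbove]
  constructor
  · rintro ⟨⟨h1, h2⟩, h3⟩
    obtain ⟨y, hy, rfl⟩ := (Finset.covBy_iff_exists_insert (s := D) (t := R)).1 (by
      rw [Finset.covBy_iff_card_sdiff_eq_one]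
      exact ⟨h3, by rw [Finset.card_sdiff_of_subset h3]; omega⟩)
    exact ⟨y, ⟨hy, h2⟩, rfl⟩
  · rintro ⟨y, ⟨hy, hd⟩, rfl⟩
    exact ⟨⟨by rw [Finset.card_insert_of_notMem hy, hcard], hd⟩, Finset.subset_insert _ _⟩

variable [DecidableEq I]

/-- The slack vertices `s i` act as the boundary: `s i` is lowest in order `i`, and the other slack
vertices lie above all ordinary ones there. -/
theorem isDominating_slack (hs : ∀ i j y, j ≠ i → y ∉ Set.range s → r i y < r i (s j))
    (hmins : ∀ i y, r i (s i) ≤ r i y) (i₀ : I) :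
    IsDominating r ((Finset.univ.erase i₀).image s) := by
  intro z
  by_cases hz : z ∈ Set.range s
  · obtain ⟨k, rfl⟩ := hz
    exact ⟨k, fun x _ => hmins k x⟩
  · refine ⟨i₀, fun x hx => ?_⟩
    obtain ⟨k, hk, rfl⟩ := Finset.mem_image.1 hx
    exact (hs i₀ k z (Finset.mem_erase.1 hk).1 hz).le

/-- A room whose colours are not all distinct contains an even number of doors. -/
theorem even_card_doors {R : Finset V} (i₀ : I)
    (hR : R.card = Fintype.card I) (hc : R.image c ≠ Finset.univ) :
    Even (R.powerset.filter fun D => D.card + 1 = Fintype.card I ∧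
      D.image c = Finset.univ.erase i₀).card := by
  by_cases hex : ∃ D ⊆ R, D.card + 1 = Fintype.card I ∧ D.image c = Finset.univ.erase i₀
  swap
  · rw [Finset.filter_eq_empty_iff.2]
    · simp
    · intro D hD h
      exact hex ⟨D, Finset.mem_powerset.1 hD, h⟩
  have hpos : 0 < Fintype.card I := Fintype.card_pos_iff.2 ⟨i₀⟩
  have herase : (Finset.univ.erase i₀).card + 1 = Fintype.card I := by
    rw [Finset.card_erase_of_mem (Finset.mem_univ _), Finset.card_univ]; omega
  obtain ⟨D, hDR, hDc, hD⟩ := hex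
  have hinjD : ∀ E : Finset V, E.card + 1 = Fintype.card I →
      E.image c = Finset.univ.erase i₀ → Set.InjOn c E := fun E h1 h2 =>
    Finset.injOn_of_card_image_eq (by rw [h2]; omega)
  obtain ⟨x, hx, rfl⟩ := (Finset.covBy_iff_exists_insert (s := D) (t := R)).1 (by
      rw [Finset.covBy_iff_card_sdiff_eq_one]
      exact ⟨hDR, by rw [Finset.card_sdiff_of_subset hDR]; omega⟩)
  have hcx : c x ≠ i₀ := by
    rintro rfl
    apply hc
    rw [Finset.image_insert, hD, Finset.insert_erase (Finset.mem_univ _)]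
  have hcx' : c x ∈ D.image c := by rw [hD]; simp [hcx]
  obtain ⟨x', hx', hxx⟩ := Finset.mem_image.1 hcx'
  have hne : x ≠ x' := by rintro rfl; exact hx hx'
  have himg : ((insert x D).erase x').image c = Finset.univ.erase i₀ := by
    rw [← hD]
    ext k
    simp only [Finset.mem_image, Finset.mem_erase, Finset.mem_insert]
    constructor
    · rintro ⟨a, ⟨-, rfl | ha⟩, rfl⟩
      exacts [⟨x', hx', hxx⟩, ⟨a, ha, rfl⟩]
    · rintro ⟨a, ha, rfl⟩
      by_cases hax : a = x'
      · subst hax; exact ⟨x, ⟨hne, Or.inl rfl⟩, hxx.symm⟩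
      · exact ⟨a, ⟨hax, Or.inr ha⟩, rfl⟩
  have hcard' : ((insert x D).erase x').card + 1 = Fintype.card I := by
    rw [Finset.card_erase_of_mem (Finset.mem_insert_of_mem hx'), hR]; omega
  -- `x` and `x'` are the only repeated colour, so a door arises exactly by removing one of them.
  have : ((insert x D).powerset.filter fun D => D.card + 1 = Fintype.card I ∧
      D.image c = Finset.univ.erase i₀) = {D, (insert x D).erase x'} := by
    ext E
    simp only [Finset.mem_filter, Finset.mem_powerset, Finset.mem_insert, Finset.mem_singleton]
    constructor
    · rintro ⟨hE, hEc, hEi⟩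
      have hnot : ¬ (x ∈ E ∧ x' ∈ E) := fun h => hne (hinjD E hEc hEi h.1 h.2 hxx.symm)
      by_cases hxE : x ∈ E
      · right
        refine Finset.eq_of_subset_of_card_le (fun a ha => ?_) (by omega)
        refine Finset.mem_erase.2 ⟨?_, hE ha⟩
        rintro rfl
        exact hnot ⟨hxE, ha⟩
      · left
        refine Finset.eq_of_subset_of_card_le (fun a ha => ?_) (by omega)
        rcases Finset.mem_insert.1 (hE ha) with rfl | h
        exacts [absurd ha hxE, h]
    · rintro (rfl | rfl)
      exacts [⟨hDR, hDc, hD⟩, ⟨Finset.erase_subset _ _, hcard', himg⟩]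
  rw [this, Finset.card_pair]
  · exact even_two
  · intro h
    rw [h] at hx'
    simp at hx'

/-- The orders whose index can be dropped without losing surjectivity of the argmin map are
exactly the two with a common argmin. -/
theorem IsDominating.eq_or_eq_of_surjOn (hcard : D.card + 1 = Fintype.card I)
    {i j l : I} (hij : i ≠ j) (hmn : mn i = mn j)
    (hsurj : ∀ x ∈ D, ∃ k, k ≠ l ∧ mn k = x) : l = i ∨ l = j := by
  by_contra! h
  -- Otherwise `l` and `i` could both be dropped, leaving too few indices to cover `D`.
  have hsub : D ⊆ ((Finset.univ.erase l).erase i).image mn := by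
    intro x hx
    obtain ⟨k, hk, rfl⟩ := hsurj x hx
    by_cases hki : k = i
    · subst hki
      exact Finset.mem_image.2 ⟨j, by simp [hij.symm, h.2.symm], hmn.symm⟩
    · exact Finset.mem_image.2 ⟨k, by simp [hk, hki], rfl⟩
  have h1 := (Finset.card_le_card hsub).trans Finset.card_image_le
  rw [Finset.card_erase_of_mem (by simp [h.1.symm]), Finset.card_erase_of_mem (by simp),
    Finset.card_univ] at h1
  have h2 : 1 < Fintype.card I := Fintype.one_lt_card_iff.2 ⟨i, j, hij⟩
  omega

/-- In a dominating `insert y D`, `y` is the minimum of some order `l`, and each vertex of `D` needs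
another order in which it is the minimum. Counting leaves only the two orders with a common argmin
for `l`, and `y` must exceed the minima of all the other orders. Maximality in order `l` then
expresses dominance. -/
theorem IsDominating.insert_iff (hr : ∀ i, Function.Injective (r i))
    (hcard : D.card + 1 = Fintype.card I)
    (hmem : ∀ k, mn k ∈ D) (hmin : ∀ k, ∀ x ∈ D, r k (mn k) ≤ r k x)
    (hD : IsDominating r D) {i j : I} (hij : i ≠ j) (hmn : mn i = mn j) (y : V) :
    y ∉ D ∧ IsDominating r (insert y D) ↔ ∃ l, (l = i ∨ l = j) ∧
      (∀ k, k ≠ l → r k (mn k) < r k y) ∧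
      ∀ z, (∀ k, k ≠ l → r k (mn k) < r k z) → r l z ≤ r l y := by
  constructor
  · rintro ⟨hy, hdom⟩
    obtain ⟨l, hl⟩ := hdom y
    have hlD : ∀ x ∈ D, r l y < r l x := fun x hx =>
      lt_of_le_of_ne (hl x (Finset.mem_insert_of_mem hx)) fun h => hy (hr l h ▸ hx)
    have key : ∀ x ∈ D, ∃ k, k ≠ l ∧ mn k = x ∧ r k (mn k) < r k y := by
      intro x hx
      obtain ⟨k, hk⟩ := hdom x
      have hkx : mn k = x := hr k (le_antisymm (hmin k x hx)
        (hk _ (Finset.mem_insert_of_mem (hmem k))))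
      refine ⟨k, ?_, hkx, ?_⟩
      · rintro rfl
        exact absurd (hk y (Finset.mem_insert_self _ _)) (not_le.2 (hlD x hx))
      · rw [hkx]
        exact lt_of_le_of_ne (hk y (Finset.mem_insert_self _ _)) fun h => hy (hr k h ▸ hx)
    have hl' := IsDominating.eq_or_eq_of_surjOn hcard hij hmn
      (fun x hx => (key x hx).imp fun k hk => ⟨hk.1, hk.2.1⟩)
    have hlt : ∀ k, k ≠ l → r k (mn k) < r k y := by
      let G := (Finset.univ.filter fun k => k ≠ l ∧ r k (mn k) < r k y)
      have hDG : D ⊆ G.image mn := by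
        intro x hx
        obtain ⟨k, h1, h2, h3⟩ := key x hx
        exact Finset.mem_image.2 ⟨k, by simp [G, h1, h3], h2⟩
      have h1 := (Finset.card_le_card hDG).trans Finset.card_image_le
      have h2 : G ⊆ Finset.univ.erase l := by
        intro k hk
        simp only [G, Finset.mem_filter] at hk
        simp [hk.2.1]
      have h3 : G = Finset.univ.erase l := Finset.eq_of_subset_of_card_le h2 (by
        rw [Finset.card_erase_of_mem (by simp), Finset.card_univ]; omega)
      intro k hk
      have : k ∈ G := by rw [h3]; simp [hk]
      exact (Finset.mem_filter.1 this).2.2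
    refine ⟨l, hl', hlt, fun z hz => ?_⟩
    obtain ⟨k, hk⟩ := hdom z
    by_cases hkl : k = l
    · subst hkl
      exact hk y (Finset.mem_insert_self _ _)
    · exact absurd (hk _ (Finset.mem_insert_of_mem (hmem k))) (not_le.2 (hz k hkl))
  · rintro ⟨l, hl, hlt, hmax⟩
    constructor
    · intro hy
      obtain ⟨k, rfl⟩ := hD.exists_argmin_eq hr hmem hmin hy
      by_cases hkl : k = l
      · rcases hl with rfl | rfl
        · have := hlt j hij.symm
          rw [hkl, hmn] at this
          exact lt_irrefl _ this
        · have := hlt i hij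
          rw [hkl, hmn] at this
          exact lt_irrefl _ this
      · exact lt_irrefl _ (hlt k hkl)
    · intro z
      by_cases hz : ∀ k, k ≠ l → r k (mn k) < r k z
      · refine ⟨l, ?_⟩
        obtain ⟨k, hk⟩ := hD z
        have hkl : k = l := by
          by_contra hkl
          exact absurd (hk _ (hmem k)) (not_le.2 (hz k hkl))
        subst hkl
        intro x hx
        rcases Finset.mem_insert.1 hx with rfl | hx
        · exact hmax z hz
        · exact hk x hx
      · push Not at hz
        obtain ⟨k, hkl, hk⟩ := hz
        refine ⟨k, fun x hx => ?_⟩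
        rcases Finset.mem_insert.1 hx with rfl | hx
        · exact hk.trans (hlt k hkl).le
        · exact hk.trans (hmin k x hx)

variable [Fintype V]

/-- Each of the two colliding orders gives exactly one completing vertex; a slack vertex shows that
candidates exist. The two differ, since a common one would lie above every minimum of `D`. -/
theorem even_card_roomsAbove (hr : ∀ i, Function.Injective (r i))
    (hs : ∀ i j y, j ≠ i → y ∉ Set.range s → r i y < r i (s j))
    (hmins : ∀ i y, r i (s i) ≤ r i y)
    (hinj : Function.Injective s)
    (hcard : D.card + 1 = Fintype.card I) (hne : D.Nonempty) (hD : IsDominating r D)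
    (hDs : ∀ k, D ≠ (Finset.univ.erase k).image s) : Even (roomsAbove r D).card := by
  obtain ⟨mn, hmem, hmin⟩ := exists_argmin hne r
  obtain ⟨i, j, hij, hmn⟩ := IsDominating.exists_argmin_collision hcard hmem
  have hslack : ∀ l k, k ≠ l → r k (mn k) < r k (s l) := by
    intro l k hkl
    by_cases hk : s k ∈ D
    · refine (hmin k _ hk).trans_lt (lt_of_le_of_ne (hmins _ _) fun h => hkl (hinj (hr k h)))
    by_cases hx : ∃ x ∈ D, x ∉ Set.range s
    · obtain ⟨x, hx, hxs⟩ := hx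
      exact (hmin k x hx).trans_lt (hs k l x hkl.symm hxs)
    · push Not at hx
      refine absurd (Finset.eq_of_subset_of_card_le ?_ ?_) (hDs k)
      · intro x hxD
        obtain ⟨a, rfl⟩ := hx x hxD
        refine Finset.mem_image_of_mem _ (Finset.mem_erase.2 ⟨?_, Finset.mem_univ _⟩)
        rintro rfl
        exact hk hxD
      · rw [Finset.card_image_of_injective _ hinj, Finset.card_erase_of_mem (Finset.mem_univ _),
          Finset.card_univ]
        omega
  have hiff := IsDominating.insert_iff hr hcard hmem hmin hD hij hmn
  obtain ⟨y, hy1, hy2⟩ := exists_argmax_above mn i (s i) (hslack i)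
  obtain ⟨z, hz1, hz2⟩ := exists_argmax_above mn j (s j) (hslack j)
  have hyD := (hiff y).2 ⟨i, Or.inl rfl, hy1, hy2⟩
  have hzD := (hiff z).2 ⟨j, Or.inr rfl, hz1, hz2⟩
  have hyz : y ≠ z := by
    rintro rfl
    obtain ⟨k, hk⟩ := hD y
    refine absurd (hk _ (hmem k)) (not_le.2 ?_)
    by_cases hki : k = i
    · exact hz1 k (by rintro rfl; exact hij hki.symm)
    · exact hy1 k hki
  have : roomsAbove r D = {insert y D, insert z D} := by
    ext R
    rw [mem_roomsAbove_iff_exists hcard, Finset.mem_insert, Finset.mem_singleton]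
    constructor
    · rintro ⟨w, hw, rfl⟩
      obtain ⟨l, rfl | rfl, h1, h2⟩ := (hiff w).1 hw
      · rw [hr _ (le_antisymm (hy2 w h1) (h2 y hy1))]; simp
      · rw [hr _ (le_antisymm (hz2 w h1) (h2 z hz1))]; simp
    · rintro (rfl | rfl)
      exacts [⟨y, hyD, rfl⟩, ⟨z, hzD, rfl⟩]
  rw [this, Finset.card_pair]
  · exact even_two
  · intro h
    have : y ∈ insert z D := h ▸ Finset.mem_insert_self _ _
    rcases Finset.mem_insert.1 this with h | h
    exacts [hyz h, hyD.1 h]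

/-- Here the collision is between `i₀` and some `m`. Dropping `m` gives no room: only slack vertices
in `D` itself could exceed `s m` in order `i₀`. -/
theorem card_roomsAbove_slack [Nontrivial I] (hr : ∀ i, Function.Injective (r i))
    (hs : ∀ i j y, j ≠ i → y ∉ Set.range s → r i y < r i (s j))
    (hmins : ∀ i y, r i (s i) ≤ r i y)
    (hinj : Function.Injective s) (i₀ : I) :
    (roomsAbove r ((Finset.univ.erase i₀).image s)).card = 1 := by
  set D := (Finset.univ.erase i₀).image s with hDdef
  have hcard : D.card + 1 = Fintype.card I := by
    rw [hDdef, Finset.card_image_of_injective _ hinj,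
      Finset.card_erase_of_mem (Finset.mem_univ _), Finset.card_univ]
    have := Fintype.one_lt_card (α := I)
    omega
  have hne : D.Nonempty := by
    have := Fintype.one_lt_card (α := I)
    exact Finset.card_pos.1 (by omega)
  have hD : IsDominating r D := isDominating_slack hs hmins i₀
  obtain ⟨mn, hmem, hmin⟩ := exists_argmin hne r
  have hmnk : ∀ k, k ≠ i₀ → mn k = s k := fun k hk => hr k (le_antisymm
    (hmin k _ (Finset.mem_image_of_mem _ (by simp [hk]))) (hmins _ _))
  obtain ⟨m, hm, hmm⟩ := Finset.mem_image.1 (hmem i₀)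
  have hm₀ : m ≠ i₀ := (Finset.mem_erase.1 hm).1
  have hiff := IsDominating.insert_iff hr hcard hmem hmin hD hm₀.symm
    (by rw [hmnk m hm₀, hmm])
  obtain ⟨y, hy1, hy2⟩ := exists_argmax_above (r := r) mn i₀ (s i₀) (fun k hk => by
    rw [hmnk k hk]
    exact lt_of_le_of_ne (hmins _ _) fun h => hk (hinj (hr k h)))
  have hyD := (hiff y).2 ⟨i₀, Or.inl rfl, hy1, hy2⟩
  rw [Finset.card_eq_one]
  refine ⟨insert y D, ?_⟩
  ext R
  rw [mem_roomsAbove_iff_exists hcard, Finset.mem_singleton]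
  constructor
  · rintro ⟨w, hw, rfl⟩
    obtain ⟨l, rfl | rfl, h1, h2⟩ := (hiff w).1 hw
    · rw [hr _ (le_antisymm (hy2 w h1) (h2 y hy1))]
    · exfalso
      have h3 := h1 i₀ hm₀.symm
      by_cases hws : w ∈ Set.range s
      · obtain ⟨a, rfl⟩ := hws
        by_cases ha : a = i₀
        · subst ha
          exact absurd (hmins a (mn a)) (not_le.2 h3)
        · exact hw.1 (Finset.mem_image_of_mem _ (by simp [ha]))
      · rw [← hmm] at h3
        exact lt_asymm h3 (hs i₀ _ w hm₀ hws)
  · rintro rfl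
    exact ⟨y, hyD, rfl⟩

/-- Scarf's lemma: there is a dominating set carrying all colours exactly once. -/
theorem exists_isDominating_image_eq_univ [Nontrivial I] (hr : ∀ i, Function.Injective (r i))
    (hs : ∀ i j y, j ≠ i → y ∉ Set.range s → r i y < r i (s j))
    (hmins : ∀ i y, r i (s i) ≤ r i y) (hcs : ∀ i, c (s i) = i) :
    ∃ R : Finset V, IsDominating r R ∧ R.image c = Finset.univ := by
  classical
  by_contra! hcon
  have hinj : Function.Injective s := Function.LeftInverse.injective (g := c) hcs
  obtain ⟨i₀⟩ := (inferInstance : Nonempty I)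
  let rooms : Finset (Finset V) :=
    Finset.univ.filter fun R => R.card = Fintype.card I ∧ IsDominating r R
  let doors : Finset (Finset V) := Finset.univ.filter fun D =>
    IsDominating r D ∧ D.card + 1 = Fintype.card I ∧ D.image c = Finset.univ.erase i₀
  -- The incidences are even in number when counted by rooms, odd when counted by doors.
  have hcount := Finset.sum_card_bipartiteAbove_eq_sum_card_bipartiteBelow
    (s := doors) (t := rooms) (fun D R => D ⊆ R)
  have hrooms : Even (∑ R ∈ rooms, (doors.bipartiteBelow (fun D R => D ⊆ R) R).card) := by
    refine Finset.even_sum _ fun R hR => ?_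
    obtain ⟨hR1, hR2⟩ := (Finset.mem_filter.1 hR).2
    have heq : doors.bipartiteBelow (fun D R => D ⊆ R) R =
        R.powerset.filter fun D => D.card + 1 = Fintype.card I ∧
          D.image c = Finset.univ.erase i₀ := by
      ext D
      simp only [doors, Finset.bipartiteBelow, Finset.mem_filter, Finset.mem_univ, true_and,
        Finset.mem_powerset]
      exact ⟨fun h => ⟨h.2, h.1.2⟩, fun h => ⟨⟨hR2.mono h.1, h.2⟩, h.1⟩⟩
    rw [heq]
    exact even_card_doors i₀ hR1 (hcon R hR2)
  have habove : ∀ D, rooms.bipartiteAbove (fun D R => D ⊆ R) D = roomsAbove r D := by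
    intro D
    ext R
    simp [rooms, Finset.bipartiteAbove, mem_roomsAbove]
  set D₀ := (Finset.univ.erase i₀).image s with hD₀
  have himg : ∀ k, ((Finset.univ.erase k).image s).image c = Finset.univ.erase k := by
    intro k
    rw [Finset.image_image]
    have : c ∘ s = id := funext hcs
    rw [this, Finset.image_id]
  have hmem₀ : D₀ ∈ doors := by
    refine Finset.mem_filter.2 ⟨Finset.mem_univ _, isDominating_slack hs hmins i₀, ?_, himg i₀⟩
    rw [hD₀, Finset.card_image_of_injective _ hinj,
      Finset.card_erase_of_mem (Finset.mem_univ _), Finset.card_univ]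
    have := Fintype.one_lt_card (α := I)
    omega
  rw [← hcount, ← Finset.add_sum_erase _ _ hmem₀, habove,
    card_roomsAbove_slack hr hs hmins hinj, Nat.even_add] at hrooms
  refine absurd (hrooms.2 (Finset.even_sum _ fun D hD => ?_)) (by decide)
  obtain ⟨hDne, hD⟩ := Finset.mem_erase.1 hD
  obtain ⟨-, h1, h2, h3⟩ := Finset.mem_filter.1 hD
  rw [habove]
  refine even_card_roomsAbove hr hs hmins hinj h2 ?_ h1 ?_
  · have := Fintype.one_lt_card (α := I)
    exact Finset.card_pos.1 (by omega)
  · rintro k rfl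
    rw [himg k] at h3
    have : k = i₀ := by
      by_contra hk
      have : k ∈ Finset.univ.erase k := by rw [h3]; simp [hk]
      simp at this
    subst this
    exact hDne rfl

end Scarf
/-! ### Brouwer's theorem on the standard simplex -/

theorem exists_image_eq_dominating {I T : Type*} [Fintype I] [DecidableEq I] [Nontrivial I]
    [Fintype T] [Nonempty T] (r : I → T → ℕ) (hr : ∀ i, Function.Injective (r i))
    (c : T → I) : ∃ (σ : Finset T) (C : Finset I), C.Nonempty ∧
      (∀ i ∈ C, ∃ x ∈ σ, c x = i) ∧ ∀ z, ∃ i ∈ C, ∀ x ∈ σ, r i z ≤ r i x := by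
  classical
  let b : ℕ := ∑ i, ∑ a, r i a + 2
  have hb : ∀ i a, r i a + 1 < b := by
    intro i a
    have h1 : r i a ≤ ∑ a, r i a :=
      Finset.single_le_sum (f := fun a => r i a) (fun _ _ => Nat.zero_le _) (Finset.mem_univ a)
    have h2 : ∑ a, r i a ≤ ∑ i, ∑ a, r i a :=
      Finset.single_le_sum (f := fun i => ∑ a, r i a) (fun _ _ => Nat.zero_le _)
        (Finset.mem_univ i)
    simp only [b]
    omega
  let e := Fintype.equivFin I
  -- The shift by one reserves rank 0 for slack vertex `i`; `b` lifts the other slack vertices above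
  -- `T`, and `e` separates them.
  let r' : I → T ⊕ I → ℕ := fun i =>
    Sum.elim (fun a => r i a + 1) (fun j => if j = i then 0 else b + e j)
  have hr' : ∀ i, Function.Injective (r' i) := by
    rintro i (a | j) (a' | j') h
    · simp only [r', Sum.elim_inl, add_left_inj] at h
      rw [hr i h]
    · have := hb i a
      simp only [r', Sum.elim_inl, Sum.elim_inr] at h
      split_ifs at h; all_goals omega
    · have := hb i a'
      simp only [r', Sum.elim_inl, Sum.elim_inr] at h
      split_ifs at h; all_goals omega
    · have : 2 ≤ b := by simp only [b]; omega
      simp only [r', Sum.elim_inr] at h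
      split_ifs at h with h1 h2 h2
      · rw [h1, h2]
      · omega
      · omega
      · rw [e.injective (Fin.ext (by omega : (e j : ℕ) = e j'))]
  obtain ⟨R, hR, hRc⟩ := exists_isDominating_image_eq_univ (r := r') (s := Sum.inr)
    (c := Sum.elim c id) hr'
    (by
      rintro i j (a | k) hji hy
      · have := hb i a
        simp only [r', Sum.elim_inl, Sum.elim_inr, if_neg hji]
        omega
      · exact absurd ⟨k, rfl⟩ hy)
    (by intro i y; simp [r'])
    (by intro i; rfl)
  -- If slack vertex `i` is in `R`, order `i` cannot witness dominance over a point of `T`; if not,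
  -- colour `i` comes from `T`.
  let C : Finset I := Finset.univ.filter fun i => Sum.inr i ∉ R
  have hdom : ∀ z, ∃ i ∈ C, ∀ x ∈ R.toLeft, r i z ≤ r i x := by
    intro z
    obtain ⟨i, hi⟩ := hR (Sum.inl z)
    refine ⟨i, Finset.mem_filter.2 ⟨Finset.mem_univ _, fun h => ?_⟩, fun x hx => ?_⟩
    · have := hi _ h
      simp [r'] at this
    · have := hi _ (Finset.mem_toLeft.1 hx)
      simpa [r'] using this
  refine ⟨R.toLeft, C, ?_, fun i hi => ?_, hdom⟩
  · obtain ⟨i, hi, -⟩ := hdom (Classical.arbitrary T)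
    exact ⟨i, hi⟩
  · have : i ∈ R.image (Sum.elim c id) := by rw [hRc]; exact Finset.mem_univ _
    obtain ⟨x | j, hx, rfl⟩ := Finset.mem_image.1 this
    · exact ⟨x, Finset.mem_toLeft.2 hx, rfl⟩
    · exact absurd hx (Finset.mem_filter.1 hi).2

/-- A coloured integer grid in a simplex has a small cluster of points whose colours `C` include
all coordinates that are not small on the cluster. -/
theorem exists_grid_cluster {I : Type*} [Fintype I] [Nontrivial I] (N : ℕ)
    (c : (I → ℕ) → I) : ∃ (C : Finset I) (x : I → ℕ), ∑ i, x i = N ∧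
      (∀ j ∉ C, x j ≤ Fintype.card I) ∧
      ∀ i ∈ C, ∃ z : I → ℕ, ∑ i, z i = N ∧ c z = i ∧
        ∀ j, z j ≤ x j + Fintype.card I ∧ x j ≤ z j + Fintype.card I := by
  classical
  let T := {a : I → Fin (N + 1) // ∑ i, (a i : ℕ) = N}
  let v : T → I → ℕ := fun a i => a.1 i
  have hv : ∀ a, ∑ i, v a i = N := fun a => a.2
  have hlift : ∀ z : I → ℕ, ∑ i, z i = N → ∃ a, v a = z := by
    intro z hz
    have hle : ∀ i, z i < N + 1 := fun i => Nat.lt_succ_of_le (hz ▸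
      Finset.single_le_sum (f := z) (fun _ _ => Nat.zero_le _) (Finset.mem_univ i))
    exact ⟨⟨fun i => ⟨z i, hle i⟩, hz⟩, rfl⟩
  obtain ⟨i₀⟩ := (inferInstance : Nonempty I)
  obtain ⟨a₀, -⟩ := hlift (Pi.single i₀ N) (by simp)
  have : Nonempty T := ⟨a₀⟩
  let e := Fintype.equivFin T
  -- Coordinate order, with ties broken by `e`.
  let r : I → T → ℕ := fun i a => v a i * Fintype.card T + e a
  have hle : ∀ i a a', r i a ≤ r i a' → v a i ≤ v a' i := by
    intro i a a' h
    by_contra! hlt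
    have h1 := Nat.mul_le_mul_right (Fintype.card T) (Nat.succ_le_of_lt hlt)
    rw [Nat.succ_mul] at h1
    have h2 := (e a').2
    simp only [r] at h
    omega
  have hr : ∀ i, Function.Injective (r i) := by
    intro i a a' h
    have h1 := le_antisymm (hle i a a' h.le) (hle i a' a h.ge)
    simp only [r, h1, add_right_inj] at h
    exact e.injective (Fin.ext h)
  obtain ⟨σ, C, hC, hcol, hdom⟩ := exists_image_eq_dominating r hr (fun a => c (v a))
  have hσ : σ.Nonempty := by
    obtain ⟨i, hi⟩ := hC
    obtain ⟨x, hx, -⟩ := hcol i hi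
    exact ⟨x, hx⟩
  choose a ha hmin using fun i => Finset.exists_min_image σ (fun x => v x i) hσ
  let m : I → ℕ := fun i => v (a i) i
  have hm : ∀ i, ∀ x ∈ σ, m i ≤ v x i := hmin
  -- Otherwise some grid point exceeds every minimum `m i`, `i ∈ C`, against dominance; the surplus
  -- is placed on `i₁` to reach the sum `N`.
  have hbig : N < ∑ i ∈ C, m i + Fintype.card I := by
    by_contra! hN
    obtain ⟨i₁, hi₁⟩ := hC
    have hsum : ∑ i, (if i ∈ C then m i + 1 else 0) ≤ N := by
      rw [Finset.sum_ite_mem, Finset.univ_inter, Finset.sum_add_distrib]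
      have := Finset.card_le_univ C
      simp only [Finset.sum_const, smul_eq_mul, mul_one]
      omega
    obtain ⟨z, hz⟩ := hlift (fun i => (if i ∈ C then m i + 1 else 0) +
      if i = i₁ then N - ∑ i, (if i ∈ C then m i + 1 else 0) else 0) (by
        rw [Finset.sum_add_distrib, Finset.sum_ite_eq']
        simp only [Finset.mem_univ, if_true]
        omega)
    obtain ⟨i, hi, hzi⟩ := hdom z
    have h1 := hle _ _ _ (hzi _ (ha i))
    rw [hz] at h1
    simp only [hi, if_true, m] at h1
    omega
  have hclose : ∀ x ∈ σ, ∀ j, v x j ≤ (if j ∈ C then m j else 0) + Fintype.card I := by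
    intro x hx j
    have h1 : ∑ i ∈ Finset.univ.erase j, (if i ∈ C then m i else 0) ≤
        ∑ i ∈ Finset.univ.erase j, v x i := by
      refine Finset.sum_le_sum fun i _ => ?_
      split_ifs
      exacts [hm i x hx, Nat.zero_le _]
    have h2 := Finset.add_sum_erase Finset.univ (v x) (Finset.mem_univ j)
    have h3 := Finset.add_sum_erase Finset.univ (fun i => if i ∈ C then m i else 0)
      (Finset.mem_univ j)
    rw [Finset.sum_ite_mem Finset.univ, Finset.univ_inter] at h3
    rw [hv x] at h2
    omega
  have hlow : ∀ x ∈ σ, ∀ j, (if j ∈ C then m j else 0) ≤ v x j := by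
    intro x hx j
    split_ifs
    exacts [hm j x hx, Nat.zero_le _]
  obtain ⟨x, hx⟩ := hσ
  refine ⟨C, v x, hv x, fun j hj => by simpa [hj] using hclose x hx j, fun i hi => ?_⟩
  obtain ⟨z, hz, hcz⟩ := hcol i hi
  refine ⟨v z, hv z, hcz, fun j => ?_⟩
  have h1 := hclose x hx j
  have h2 := hclose z hz j
  have h3 := hlow x hx j
  have h4 := hlow z hz j
  omega

/-- For a colour in `C`, uniform continuity carries the inequality from a nearby grid point of that
colour to `x`. Any other coordinate of `x` is itself below `ε`. -/
theorem exists_forall_sub_le_of_continuousOn_stdSimplex {I : Type*} [Fintype I] [Nontrivial I]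
    {f : (I → ℝ) → I → ℝ} (hf : ContinuousOn f (stdSimplex ℝ I))
    (hmaps : Set.MapsTo f (stdSimplex ℝ I) (stdSimplex ℝ I)) {ε : ℝ} (hε : 0 < ε) :
    ∃ x ∈ stdSimplex ℝ I, ∀ i, x i - ε ≤ f x i := by
  classical
  have hunif := (isCompact_stdSimplex ℝ I).uniformContinuousOn_of_continuous hf
  obtain ⟨δ, hδ, hδf⟩ := Metric.uniformContinuousOn_iff.1 hunif (ε / 2) (half_pos hε)
  obtain ⟨n, hn⟩ : ∃ n : ℝ, n = Fintype.card I := ⟨_, rfl⟩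
  have hn0 : 0 ≤ n := hn ▸ Nat.cast_nonneg _
  obtain ⟨N, hN⟩ := exists_nat_gt (n / min δ (ε / 2))
  have hmpos : 0 < min δ (ε / 2) := lt_min hδ (half_pos hε)
  have hNpos : (0 : ℝ) < N := lt_of_le_of_lt (by positivity) hN
  have hnN : n / N < min δ (ε / 2) := by
    rw [div_lt_iff₀ hmpos] at hN
    rw [div_lt_iff₀ hNpos]
    linarith
  let p : (I → ℕ) → I → ℝ := fun a i => a i / N
  have hp : ∀ a, ∑ i, a i = N → p a ∈ stdSimplex ℝ I := by
    intro a ha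
    refine ⟨fun i => by positivity, ?_⟩
    simp only [p]
    rw [← Finset.sum_div, ← Nat.cast_sum, ha, div_self hNpos.ne']
  have hcol : ∀ a : I → ℕ, ∃ i, p a ∈ stdSimplex ℝ I → p a i ≤ f (p a) i := by
    intro a
    by_contra! h
    obtain ⟨i₀⟩ := (inferInstance : Nonempty I)
    have hmem := (h i₀).1
    have := Finset.sum_lt_sum_of_nonempty (Finset.univ_nonempty (α := I)) fun i _ => (h i).2
    rw [hmem.2, (hmaps hmem).2] at this
    exact lt_irrefl _ this
  choose c hc using hcol
  obtain ⟨C, x, hx, hsmall, hC⟩ := exists_grid_cluster N c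
  refine ⟨p x, hp x hx, fun i => ?_⟩
  by_cases hi : i ∈ C
  · obtain ⟨z, hz, rfl, hzx⟩ := hC i hi
    have hd : ∀ j, |p x j - p z j| ≤ n / N := by
      intro j
      have h1 : (z j : ℝ) ≤ x j + n := by rw [hn]; exact_mod_cast (hzx j).1
      have h2 : (x j : ℝ) ≤ z j + n := by rw [hn]; exact_mod_cast (hzx j).2
      simp only [p]
      rw [← sub_div, abs_div, abs_of_pos hNpos]
      gcongr
      rw [abs_le]
      constructor <;> linarith
    have hdist : dist (p x) (p z) < δ := by
      refine lt_of_le_of_lt ?_ (hnN.trans_le (min_le_left _ _))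
      rw [dist_pi_le_iff (by positivity)]
      exact fun j => by rw [Real.dist_eq]; exact hd j
    have h1 := (dist_le_pi_dist (f (p x)) (f (p z)) (c z)).trans_lt
      (hδf _ (hp x hx) _ (hp z hz) hdist)
    rw [Real.dist_eq, abs_lt] at h1
    have h2 := hc z (hp z hz)
    have h3 := (abs_le.1 (hd (c z))).2
    have h4 := hnN.trans_le (min_le_right _ _)
    linarith [h1.1]
  · have h1 : (x i : ℝ) ≤ n := by rw [hn]; exact_mod_cast hsmall i hi
    have h2 : p x i ≤ n / N := by simp only [p]; gcongr
    have h3 := (hmaps (hp x hx)).1 i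
    have h4 := hnN.trans_le (min_le_right _ _)
    linarith

theorem exists_fixedPoint_stdSimplex {I : Type*} [Fintype I] [Nonempty I]
    {f : (I → ℝ) → I → ℝ} (hf : ContinuousOn f (stdSimplex ℝ I))
    (hmaps : Set.MapsTo f (stdSimplex ℝ I) (stdSimplex ℝ I)) :
    ∃ x ∈ stdSimplex ℝ I, f x = x := by
  classical
  rcases subsingleton_or_nontrivial I with hI | hI
  · obtain ⟨i₀⟩ := (inferInstance : Nonempty I)
    have hx := single_mem_stdSimplex ℝ i₀
    refine ⟨_, hx, funext fun i => ?_⟩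
    have h1 := (hmaps hx).2
    have h2 := hx.2
    rw [Fintype.sum_subsingleton _ i] at h1 h2
    rw [h1, h2]
  -- The total defect attains its minimum, which approximate fixed points force to be 0. Then `x ≤ f
  -- x` with equal sums gives equality.
  have hcont : ContinuousOn (fun x => ∑ i, max 0 (x i - f x i)) (stdSimplex ℝ I) :=
    continuousOn_finsetSum _ fun i _ => continuousOn_const.sup
      ((continuous_apply i).continuousOn.sub (continuousOn_pi.1 hf i))
  obtain ⟨i₀⟩ := (inferInstance : Nonempty I)
  obtain ⟨x, hx, hmin⟩ := (isCompact_stdSimplex ℝ I).exists_isMinOn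
    ⟨_, single_mem_stdSimplex ℝ i₀⟩ hcont
  refine ⟨x, hx, ?_⟩
  have hle : ∑ i, max 0 (x i - f x i) ≤ 0 := by
    refine le_of_forall_pos_le_add fun ε hε => ?_
    have hcard : (0 : ℝ) < Fintype.card I := by exact_mod_cast Fintype.card_pos
    obtain ⟨y, hy, hyε⟩ := exists_forall_sub_le_of_continuousOn_stdSimplex hf hmaps
      (div_pos hε hcard)
    refine (hmin hy).trans ?_
    calc ∑ i, max 0 (y i - f y i) ≤ ∑ _i : I, ε / Fintype.card I :=
          Finset.sum_le_sum fun i _ => max_le (div_pos hε hcard).le (by linarith [hyε i])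
      _ = 0 + ε := by
          rw [Finset.sum_const, Finset.card_univ, nsmul_eq_mul, zero_add]
          field_simp
  have hxf : ∀ i ∈ Finset.univ, x i ≤ f x i := by
    intro i hi
    have h1 := Finset.single_le_sum (f := fun i => max 0 (x i - f x i))
      (fun i _ => le_max_left _ _) hi
    have h2 := le_max_right 0 (x i - f x i)
    linarith
  have heq := (Finset.sum_eq_sum_iff_of_le hxf).1 (by rw [hx.2, (hmaps hx).2])
  exact funext fun i => (heq i (Finset.mem_univ i)).symm
/-! ### Ky Fan's inequality and the equilibrium -/

/-- Nash's map shifts weight towards the `y i` with `f (b w) (y i) > 0`. At a fixed point with some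
positive gain, every `y i` of positive weight has positive gain, so concavity makes `f (b w) (b w)`
positive. -/
theorem exists_mem_forall_finite_le_zero {E I : Type*} [AddCommGroup E] [Module ℝ E]
    [TopologicalSpace E] [IsTopologicalAddGroup E] [ContinuousSMul ℝ E] [Fintype I] [Nonempty I]
    {K : Set E} (hK : Convex ℝ K) {f : E → E → ℝ} (hcont : ∀ y, Continuous fun x => f x y)
    (hconc : ∀ x ∈ K, ConcaveOn ℝ K (f x)) (hdiag : ∀ x ∈ K, f x x ≤ 0)
    (y : I → E) (hy : ∀ i, y i ∈ K) : ∃ x ∈ K, ∀ i, f x (y i) ≤ 0 := by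
  let b : (I → ℝ) → E := fun w => ∑ i, w i • y i
  have hb : Continuous b := by fun_prop
  have hbK : ∀ w ∈ stdSimplex ℝ I, b w ∈ K := fun w hw =>
    hK.sum_mem (fun i _ => hw.1 i) hw.2 fun i _ => hy i
  let g : (I → ℝ) → I → ℝ := fun w i => max 0 (f (b w) (y i))
  have hg : ∀ i, Continuous fun w => g w i := fun i =>
    continuous_const.max ((hcont (y i)).comp hb)
  have hg0 : ∀ w i, 0 ≤ g w i := fun w i => le_max_left _ _
  have hG0 : ∀ w, 0 ≤ ∑ i, g w i := fun w => Finset.sum_nonneg fun i _ => hg0 w i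
  have hpos : ∀ w, 0 < 1 + ∑ i, g w i := fun w => by linarith [hG0 w]
  obtain ⟨w, hw, hfix⟩ := exists_fixedPoint_stdSimplex
    (f := fun w i => (w i + g w i) / (1 + ∑ i, g w i))
    (continuous_pi fun i => ((continuous_apply i).add (hg i)).div
      (continuous_const.add (continuous_finsetSum _ fun i _ => hg i))
      fun w => (hpos w).ne').continuousOn
    (fun w hw => ⟨fun i => div_nonneg (add_nonneg (hw.1 i) (hg0 w i)) (hpos w).le, by
      rw [← Finset.sum_div, Finset.sum_add_distrib, hw.2, div_self (hpos w).ne']⟩)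
  have hfix' : ∀ i, g w i = w i * ∑ i, g w i := by
    intro i
    have := congrFun hfix i
    rw [div_eq_iff (hpos w).ne'] at this
    linarith
  refine ⟨b w, hbK w hw, ?_⟩
  by_contra! hcon
  obtain ⟨j, hj⟩ := hcon
  have hG : 0 < ∑ i, g w i := (lt_max_of_lt_right hj).trans_le
    (Finset.single_le_sum (f := g w) (fun i _ => hg0 w i) (Finset.mem_univ j))
  have hterm : ∀ i, 0 ≤ w i * f (b w) (y i) ∧ (0 < w i → 0 < w i * f (b w) (y i)) := by
    intro i
    have hlt : 0 < w i → 0 < w i * f (b w) (y i) := fun h => by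
      have h1 : 0 < g w i := by rw [hfix' i]; positivity
      exact mul_pos h ((lt_max_iff.1 h1).resolve_left (lt_irrefl _))
    refine ⟨?_, hlt⟩
    rcases (hw.1 i).eq_or_lt with h | h
    · rw [← h, zero_mul]
    · exact (hlt h).le
  have hwj : 0 < w j := by
    have h1 : 0 < w j * ∑ i, g w i := by rw [← hfix' j]; exact lt_max_of_lt_right hj
    exact pos_of_mul_pos_left h1 hG.le
  have hsum : 0 < ∑ i, w i * f (b w) (y i) :=
    Finset.sum_pos' (fun i _ => (hterm i).1) ⟨j, Finset.mem_univ j, (hterm j).2 hwj⟩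
  have hle := (hconc _ (hbK w hw)).le_map_sum (t := Finset.univ) (fun i _ => hw.1 i) hw.2
    (fun i _ => hy i)
  simp only [smul_eq_mul] at hle
  exact absurd (hdiag _ (hbK w hw)) (not_le.2 (hsum.trans_le hle))

/-- Ky Fan's inequality. -/
theorem exists_mem_forall_le_zero_of_concaveOn {E : Type*} [AddCommGroup E] [Module ℝ E]
    [TopologicalSpace E] [IsTopologicalAddGroup E] [ContinuousSMul ℝ E]
    {K : Set E} (hne : K.Nonempty) (hcpt : IsCompact K) (hK : Convex ℝ K) {f : E → E → ℝ}
    (hcont : ∀ y, Continuous fun x => f x y)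
    (hconc : ∀ x ∈ K, ConcaveOn ℝ K (f x)) (hdiag : ∀ x ∈ K, f x x ≤ 0) :
    ∃ x ∈ K, ∀ y ∈ K, f x y ≤ 0 := by
  -- Finite intersection property of the closed sets `{x | f x y ≤ 0}` in `K`.
  obtain ⟨x, hx, hxt⟩ := hcpt.inter_iInter_nonempty (fun y : K => {x | f x y ≤ 0})
    (fun y => isClosed_le (hcont y) continuous_const) (by
      intro u
      rcases u.eq_empty_or_nonempty with rfl | hu
      · simpa using hne
      · have : Nonempty u := hu.to_subtype
        obtain ⟨x, hx, hxu⟩ := exists_mem_forall_finite_le_zero hK hcont hconc hdiag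
          (fun i : u => (i.1 : E)) fun i => i.1.2
        exact ⟨x, hx, Set.mem_iInter₂.2 fun i hi => hxu ⟨i, hi⟩⟩)
  exact ⟨x, hx, fun y hy => Set.mem_iInter.1 hxt ⟨y, hy⟩⟩

/-! ### The game with bilinear payoffs -/

theorem continuous_bilinearPayoff {k l : ℕ} (M : Matrix (Fin k) (Fin l) ℝ) :
    Continuous fun z : EuclideanSpace ℝ (Fin k) × EuclideanSpace ℝ (Fin l) =>
      bilinearPayoff M z.1 z.2 := by
  unfold bilinearPayoff Matrix.mulVec dotProduct
  fun_prop

theorem bilinearPayoff_smul_add_smul {k l : ℕ} (M : Matrix (Fin k) (Fin l) ℝ) (a b : ℝ)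
    (x x' : EuclideanSpace ℝ (Fin k)) (y : EuclideanSpace ℝ (Fin l)) :
    bilinearPayoff M (a • x + b • x') y =
      a * bilinearPayoff M x y + b * bilinearPayoff M x' y := by
  simp [bilinearPayoff, add_dotProduct, smul_dotProduct]

theorem theorem3p3 (m n : ℕ)
    (Ω₁ : Set (EuclideanSpace ℝ (Fin m))) (Ω₂ : Set (EuclideanSpace ℝ (Fin n)))
    (hne₁ : Ω₁.Nonempty) (hcpt₁ : IsCompact Ω₁) (hconv₁ : Convex ℝ Ω₁)
    (hne₂ : Ω₂.Nonempty) (hcpt₂ : IsCompact Ω₂) (hconv₂ : Convex ℝ Ω₂)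
    (A : Matrix (Fin m) (Fin n) ℝ) (B : Matrix (Fin n) (Fin m) ℝ) :
    ∃ z : EuclideanSpace ℝ (Fin m) × EuclideanSpace ℝ (Fin n),
      IsNashEquilibrium Ω₁ Ω₂
        (fun p q => bilinearPayoff A p q) (fun p q => bilinearPayoff B q p) z := by
  have hconv := hconv₁.prod hconv₂
  have hA := continuous_bilinearPayoff A
  have hB := continuous_bilinearPayoff B
  obtain ⟨z, hz, hmax⟩ := exists_mem_forall_le_zero_of_concaveOn
    (f := fun x y => bilinearPayoff A y.1 x.2 + bilinearPayoff B y.2 x.1 -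
      (bilinearPayoff A x.1 x.2 + bilinearPayoff B x.2 x.1))
    (hne₁.prod hne₂) (hcpt₁.prod hcpt₂) hconv
    (fun y => ((hA.comp (continuous_const.prodMk continuous_snd)).add
      (hB.comp (continuous_const.prodMk continuous_fst))).sub
      (hA.add (hB.comp continuous_swap)))
    (fun x _ => ⟨hconv, fun y _ y' _ a b _ _ hab => by
      have hb : b = 1 - a := by linarith
      simp only [Prod.fst_add, Prod.snd_add, Prod.smul_fst, Prod.smul_snd,
        bilinearPayoff_smul_add_smul, smul_eq_mul]
      subst hb
      linarith⟩)
    (fun x _ => (sub_self _).le)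
  refine ⟨z, hz, fun p hp => ?_, fun q hq => ?_⟩
  -- Deviating in one component only cancels the other player's terms.
  · have := hmax (p, z.2) ⟨hp, hz.2⟩
    simp only at this ⊢
    linarith
  · have := hmax (z.1, q) ⟨hz.1, hq⟩
    simp only at this ⊢
    linarith
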